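/- Let $\mathbf G$ be a directed acyclic graph on $[d]=\{1,\dots,d\}$, with parent sets $\mathrm{pa}_i$ and child sets $\mathrm{ch}_i$, let $n_1,\dots,n_d\ge 2$ be integers, and let $K_i=\prod_{k\in \mathrm{pa}_i} n_k$ be the number of configurations of the parents of $i$. Consider structural causal models $X_i=f_i(X_{\mathrm{pa}_i},U_i)$, $i\in[d]$, where $X_i$ takes values in $[n_i]$ and the exogenous variables $U_i$ are mutually independent. Suppose that the model is random, with the symmetric Dirichlet prior of equivalent sample size $\alpha_0>0$: for every node $i$ and every parent configuration $x_{\mathrm{pa}_i}$, the row $p(X_i\mid x_{\mathrm{pa}_i})$ (the law of $f_i(x_{\mathrm{pa}_i},U_i)$) of the conditional probability table of $i$ has distribution $$\mathrm{Dirichlet}\Big(\tfrac{\alpha_0}{n_iK_i},\dots,\tfrac{\alpha_0}{n_iK_i}\Big)\qquad(n_i\text{ parameters}),$$ and the conditional probability tables of different nodes are independent. For a given model let $H(X_i\mid X_{\mathrm{pa}_i})=\mathbb E_{X_{\mathrm{pa}_i}}\big[H(p(X_i\mid x_{\mathrm{pa}_i}))\big]$, where $H(p)=-\sum_k p_k\log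 p_k$ is the Shannon entropy, and let $\overline H_i$ be its expectation over the random model. Put $c(m)=\frac32 m+\frac12$. Then there is a threshold $A>0$, depending only on $\mathbf G$ and $(n_1,\dots,n_d)$, such that for every $\alpha_0\ge A$ and every such random model the following holds. If $$\log\frac{n_j}{n_i}+\alpha_0^{-1}\big[K_i\,c(n_i)-K_j\,c(n_j)\big]\ge 0\qquad\text{for all } i\in[d] \text{ and all } j\in\mathrm{ch}_i,$$ then each $H(X_i\mid X_{\mathrm{pa}_i})$ is an integrable function of the random model, and the non-decreasing randomness condition holds for the Shannon entropy: $$\overline H_i\le \min_{j\in \mathrm{ch}_i}\overline H_j\qquad\text{for all } i\in[d]\text{ with } \mathrm{ch}_i\neq\emptyset .$$ -/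

import Mathlib

open MeasureTheory ProbabilityTheory

universe u v

/-- A directed acyclic graph on the nodes `Fin d`, given by its parent sets. -/
structure DAG (d : ℕ) where
  /-- The parents of a node. -/
  parents : Fin d → Finset (Fin d)
  /-- No directed path of positive length returns to its start; in particular, no self-loops. -/
  acyclic : ∀ i, ¬ Relation.TransGen (fun a b => a ∈ parents b) i i

namespace DAG

variable {d : ℕ}

/-- The children of a node. -/
def children (G : DAG d) (i : Fin d) : Finset (Fin d) :=
  Finset.univ.filter fun j => i ∈ G.parents j

/-- The configurations of the parents of node `i`, when node `k` has the states `Fin (n k)`. -/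
abbrev Config (G : DAG d) (n : Fin d → ℕ) (i : Fin d) : Type :=
  ∀ k : G.parents i, Fin (n k)

/-- The number of configurations of the parents of node `i`. -/
def numConfigs (G : DAG d) (n : Fin d → ℕ) (i : Fin d) : ℕ :=
  Fintype.card (G.Config n i)

/-- The configuration of the parents of node `i` in a joint state `x`. -/
def config (G : DAG d) (n : Fin d → ℕ) (i : Fin d) (x : ∀ k, Fin (n k)) : G.Config n i :=
  fun k => x k

theorem wellFounded_parents (G : DAG d) : WellFounded fun a b => a ∈ G.parents b := by
  have : Std.Irrefl (Relation.TransGen fun a b => a ∈ G.parents b) := ⟨G.acyclic⟩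
  have h := Finite.wellFounded_of_trans_of_irrefl (Relation.TransGen fun a b => a ∈ G.parents b)
  exact Subrelation.wf (fun hab => Relation.TransGen.single hab) h

end DAG

/-- A structural causal model over the graph `G`, with node `i` taking values in `Fin (n i)`:
one exogenous noise space with its law and one mechanism for each node. The exogenous variables
are jointly distributed according to the product of the noise laws, so they are independent. -/
structure DiscreteSCM {d : ℕ} (G : DAG d) (n : Fin d → ℕ) where
  /-- The space of the exogenous variable of a node. -/
  Noise : Fin d → Type v
  /-- Its measurable structure. -/
  measurableSpace : ∀ i, MeasurableSpace (Noise i)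
  /-- The law of the exogenous variable. -/
  noiseLaw : ∀ i, Measure (Noise i)
  isProbabilityMeasure : ∀ i, IsProbabilityMeasure (noiseLaw i)
  /-- The function that assigns to a node its value, from its parents and its noise. -/
  mech : ∀ i, G.Config n i → Noise i → Fin (n i)
  measurable_mech : ∀ i y, Measurable (mech i y)

namespace DiscreteSCM

attribute [instance] DiscreteSCM.measurableSpace DiscreteSCM.isProbabilityMeasure

variable {d : ℕ} {G : DAG d} {n : Fin d → ℕ}

/-- The endogenous variables as functions of the exogenous ones: the solution of the structural
equations, computed along the graph. -/
noncomputable def solve (M : DiscreteSCM G n) (u : ∀ i, M.Noise i) : ∀ i, Fin (n i) :=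
  G.wellFounded_parents.fix fun i x => M.mech i (fun k => x k.1 k.2) (u i)

/-- The structural equations. -/
theorem solve_apply (M : DiscreteSCM G n) (u : ∀ i, M.Noise i) (i : Fin d) :
    M.solve u i = M.mech i (G.config n i (M.solve u)) (u i) :=
  G.wellFounded_parents.fix_eq _ i

theorem measurable_solve (M : DiscreteSCM G n) : Measurable M.solve := by
  refine measurable_pi_iff.2 fun i => ?_
  induction i using G.wellFounded_parents.induction with
  | _ i ih =>
    have hc : Measurable fun u => G.config n i (M.solve u) :=
      measurable_pi_iff.2 fun k => ih k.1 k.2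
    have hm : Measurable fun p : G.Config n i × M.Noise i => M.mech i p.1 p.2 :=
      measurable_from_prod_countable_right fun y => M.measurable_mech i y
    have he : (fun u => M.solve u i)
        = fun u => M.mech i (G.config n i (M.solve u)) (u i) :=
      funext fun u => M.solve_apply u i
    rw [he]
    exact hm.comp (hc.prodMk (measurable_pi_apply i))

/-- The joint law of the endogenous variables. -/
noncomputable def law (M : DiscreteSCM G n) : Measure (∀ i, Fin (n i)) :=
  (Measure.pi M.noiseLaw).map M.solve

/-- The conditional probability table of node `i`. Its row at the parent configuration `y` is the
law of `mech i y U_i`, as a probability vector. -/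
noncomputable def cpt (M : DiscreteSCM G n) (i : Fin d) (y : G.Config n i) : Fin (n i) → ℝ :=
  fun k => (M.noiseLaw i).real (M.mech i y ⁻¹' {k})

end DiscreteSCM

/-- The Shannon entropy of a probability vector (natural logarithm). -/
noncomputable def shannonEntropy {m : ℕ} (p : Fin m → ℝ) : ℝ :=
  ∑ k, Real.negMulLog (p k)

/-- The conditional information `φ(X | Y) = E_Y [φ(p(X | y))]` of discrete random variables `X`
and `Y` under `μ`, for a function `φ` of probability vectors. -/
noncomputable def condInfo {𝓧 β : Type*} [MeasurableSpace 𝓧] [Fintype β] {m : ℕ}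
    (φ : (Fin m → ℝ) → ℝ) (μ : Measure 𝓧) (X : 𝓧 → Fin m) (Y : 𝓧 → β) : ℝ :=
  ∑ y, μ.real (Y ⁻¹' {y}) * φ fun k => (μ[|Y ⁻¹' {y}]).real (X ⁻¹' {k})

/-- The Shannon conditional entropy `H(X_i | X_{pa_i})` in the joint law of the model. -/
noncomputable def DiscreteSCM.condEntropy {d : ℕ} {G : DAG d} {n : Fin d → ℕ}
    (M : DiscreteSCM G n) (i : Fin d) : ℝ :=
  condInfo shannonEntropy M.law (fun x => x i) (G.config n i)

/-- The non-decreasing randomness condition with respect to `G`, for the values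
`h i = φ(X_i | X_{pa_i})`: every node with children has randomness at most the minimum over its
children. -/
def NonDecreasingRandomness {d : ℕ} (G : DAG d) (h : Fin d → ℝ) : Prop :=
  ∀ (i : Fin d) (hi : (G.children i).Nonempty), h i ≤ (G.children i).inf' hi h

/-- The Dirichlet distribution with positive parameters `a`: the law of the vector obtained by
normalizing independent `Gamma(a k, 1)` variables to have sum one. -/
noncomputable def dirichletMeasure {m : ℕ} (a : Fin m → ℝ) : Measure (Fin m → ℝ) :=
  (Measure.pi fun k => gammaMeasure (a k) 1).map fun g k => g k / ∑ l, g l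

/-- A random structural causal model `M`, defined on the probability space `(Ω, P)`, with the
symmetric Dirichlet prior of equivalent sample size `α₀`: every row of the table of node `i` has
law `Dirichlet(α₀ / (n i * K i), …, α₀ / (n i * K i))`, where `K i` is the number of rows, and the
tables of different nodes are independent. -/
structure IsSymmetricDirichletSCM {d : ℕ} {G : DAG d} {n : Fin d → ℕ} {Ω : Type u}
    [MeasurableSpace Ω] (P : Measure Ω) (M : Ω → DiscreteSCM.{v} G n) (α₀ : ℝ) : Prop where
  hasLaw_row : ∀ i y, HasLaw (fun ω => (M ω).cpt i y)
    (dirichletMeasure fun _ => α₀ / ((n i : ℝ) * (G.numConfigs n i : ℝ))) P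
  indep : iIndepFun (fun i ω => (M ω).cpt i) P

/-- The expectation of `H(X_i | X_{pa_i})` over the random model. -/
noncomputable def expectedCondEntropy {d : ℕ} {G : DAG d} {n : Fin d → ℕ} {Ω : Type u}
    [MeasurableSpace Ω] (P : Measure Ω) (M : Ω → DiscreteSCM.{v} G n) (i : Fin d) : ℝ :=
  ∫ ω, (M ω).condEntropy i ∂P

/-- The coefficient function `c(m) = 3m/2 + 1/2`. -/
noncomputable def cCoeff (m : ℕ) : ℝ := 3 / 2 * (m : ℝ) + 1 / 2

/-!
For large `α₀` the mean entropies `H̄ i` have a simple asymptotic form, which decides every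
comparison of a parent `i` with a child `j`.

*Closed form.* Under the intervention that fixes the value of `i`, the parents of `i` keep their
law, so the probability of a parent configuration `y` is a polynomial in the tables of the other
nodes (`DiscreteSCM.law_real_config`), and the conditional law of `i` given `y` is the row of its
table (`DiscreteSCM.condEntropy_eq`). As the tables of different nodes are independent, `H̄ i` is a
weighted mean, with weights of sum one, of the mean entropy of a row, hence equal to it. Dependence
between the rows of one table plays no role.

*Entropy of a Dirichlet vector.* Let the vector be `g / S`, with `g` independent gamma variables and
`S` their sum. Scaling `g` tilts its law by an exponential of `S`, so `S` is independent of every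
scale-invariant function of `g` and has the gamma law with the sum of the parameters
(`map_sum_withDensity_pi_gammaMeasure`). The identity `H(g / S) S = S log S - ∑ g_k log g_k` and
`E[x log x] = a ψ(a + 1)` for a gamma variable with parameter `a`, where `ψ = Γ' / Γ`, then give
`H̄ i = ψ(α₀ / K_i + 1) - ψ(α₀ / (n_i K_i) + 1)`
(`integral_shannonEntropy_symmetric_dirichletMeasure`).

*Comparison.* From `|ψ(x + 1) - log x - 1 / (2 x)| ≤ 1 / (8 x ^ 2)` one has
`H̄ i = log n_i - K_i (n_i - 1) / (2 α₀) + O(α₀⁻²)`. If `n_i < n_j` then `H̄ i < H̄ j` for large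
`α₀`. If `n_j < n_i` then the hypothesis fails for large `α₀`. If `n_i = n_j` the hypothesis says
`K_j ≤ K_i`, and the terms of order `α₀⁻¹` decide, unless `K_i = K_j` and the two means are equal
(`eventually_dirichletMeanEntropy_le_of_cCoeff`). Of the function `c` only its positivity matters.
-/

/-! ### The digamma function on the positive reals -/

section Digamma

open Filter Topology

theorem differentiableAt_Gamma_of_pos {x : ℝ} (hx : 0 < x) : DifferentiableAt ℝ Real.Gamma x :=
  Real.differentiableAt_Gamma fun m => by
    have : (0 : ℝ) ≤ m := m.cast_nonneg
    linarith

theorem hasDerivAt_log_Gamma {x : ℝ} (hx : 0 < x) :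
    HasDerivAt (Real.log ∘ Real.Gamma) (logDeriv Real.Gamma x) x := by
  have h := (differentiableAt_Gamma_of_pos hx).hasDerivAt.log (Real.Gamma_pos_of_pos hx).ne'
  simpa only [logDeriv_apply, Function.comp_def] using h

theorem logDeriv_Gamma_add_one {x : ℝ} (hx : 0 < x) :
    logDeriv Real.Gamma (x + 1) = logDeriv Real.Gamma x + x⁻¹ := by
  have h1 : HasDerivAt (fun y => (Real.log ∘ Real.Gamma) (y + 1))
      (logDeriv Real.Gamma (x + 1)) x :=
    (hasDerivAt_log_Gamma (by linarith)).comp_add_const x 1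
  have h2 : HasDerivAt (fun y => (Real.log ∘ Real.Gamma) y + Real.log y)
      (logDeriv Real.Gamma x + x⁻¹) x :=
    (hasDerivAt_log_Gamma hx).add (Real.hasDerivAt_log hx.ne')
  refine h1.unique (h2.congr_of_eventuallyEq ?_)
  filter_upwards [lt_mem_nhds hx] with y hy
  simp only [Function.comp_apply]
  rw [Real.Gamma_add_one hy.ne', Real.log_mul hy.ne' (Real.Gamma_pos_of_pos hy).ne', add_comm]

theorem slope_log_Gamma {x : ℝ} (hx : 0 < x) :
    slope (Real.log ∘ Real.Gamma) x (x + 1) = Real.log x := by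
  rw [slope_def_field, add_sub_cancel_left, div_one, Function.comp_apply, Function.comp_apply,
    Real.Gamma_add_one hx.ne', Real.log_mul hx.ne' (Real.Gamma_pos_of_pos hx).ne',
    add_sub_cancel_right]

/-- Convexity of `log Γ` compares its derivative with its unit increments. -/
theorem log_le_logDeriv_Gamma_add_one {x : ℝ} (hx : 0 < x) :
    Real.log x ≤ logDeriv Real.Gamma (x + 1) := by
  have hx1 : 0 < x + 1 := by linarith
  rw [← slope_log_Gamma hx]
  exact Real.convexOn_log_Gamma.slope_le_of_hasDerivAt hx hx1 (by linarith)
    (hasDerivAt_log_Gamma hx1)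

theorem logDeriv_Gamma_add_one_le_log {x : ℝ} (hx : 0 < x) :
    logDeriv Real.Gamma (x + 1) ≤ Real.log (x + 1) := by
  have hx1 : 0 < x + 1 := by linarith
  have hx2 : 0 < x + 1 + 1 := by linarith
  rw [← slope_log_Gamma hx1]
  exact Real.convexOn_log_Gamma.le_slope_of_hasDerivAt hx1 hx2 (by linarith)
    (hasDerivAt_log_Gamma hx1)

/-- The error of the two-term asymptotic expansion of `ψ (x + 1)`, where `ψ` is the logarithmic
derivative of `Γ`. -/
noncomputable def digammaError (x : ℝ) : ℝ :=
  logDeriv Real.Gamma (x + 1) - Real.log x - 1 / (2 * x)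

theorem tendsto_digammaError_add_nat {x : ℝ} (hx : 0 < x) :
    Tendsto (fun k : ℕ => digammaError (x + k)) atTop (𝓝 0) := by
  have ht : Tendsto (fun k : ℕ => x + (k : ℝ)) atTop atTop :=
    tendsto_atTop_add_const_left _ _ tendsto_natCast_atTop_atTop
  have hinv : Tendsto (fun k : ℕ => (x + (k : ℝ))⁻¹) atTop (𝓝 0) :=
    tendsto_inv_atTop_zero.comp ht
  refine tendsto_of_tendsto_of_tendsto_of_le_of_le
    (g := fun k : ℕ => -(x + (k : ℝ))⁻¹) (h := fun k : ℕ => (x + (k : ℝ))⁻¹)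
    (by simpa using hinv.neg) hinv (fun k => ?_) fun k => ?_
  · have hk : 0 < x + (k : ℝ) := by positivity
    have h := log_le_logDeriv_Gamma_add_one hk
    have h2 : 1 / (2 * (x + (k : ℝ))) = (x + (k : ℝ))⁻¹ / 2 := by field_simp
    have : 0 < (x + (k : ℝ))⁻¹ := by positivity
    simp only [digammaError]
    linarith
  · have hk : 0 < x + (k : ℝ) := by positivity
    have h := logDeriv_Gamma_add_one_le_log hk
    have h2 : 0 < 1 / (2 * (x + (k : ℝ))) := by positivity
    have h3 : Real.log (x + k + 1) - Real.log (x + k) ≤ (x + (k : ℝ))⁻¹ := by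
      rw [← Real.log_div (by positivity) hk.ne']
      refine (Real.log_le_sub_one_of_pos (by positivity)).trans (le_of_eq ?_)
      field_simp
      ring
    simp only [digammaError]
    linarith

theorem digammaError_add_one_sub {x : ℝ} (hx : 0 < x) :
    digammaError (x + 1) - digammaError x =
      (1 / x + 1 / (x + 1)) / 2 - Real.log (1 + 1 / x) := by
  have h : Real.log (1 + 1 / x) = Real.log (x + 1) - Real.log x := by
    rw [← Real.log_div (by positivity) hx.ne']
    congr 1
    field_simp
  rw [h, digammaError, digammaError, logDeriv_Gamma_add_one (by linarith : 0 < x + 1)]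
  field_simp
  ring

/-- The trapezoidal rule overestimates the integral of `1 / y` over `[x, x + 1]`. -/
theorem log_one_add_inv_le {x : ℝ} (hx : 0 < x) :
    Real.log (1 + 1 / x) ≤ (1 / x + 1 / (x + 1)) / 2 := by
  have h1 : 1 ≤ 1 + 1 / x := by
    have : 0 < 1 / x := by positivity
    linarith
  have h := Real.self_le_sinh_iff.2 (Real.log_nonneg h1)
  rw [Real.sinh_log (by positivity)] at h
  refine h.trans (le_of_eq ?_)
  field_simp
  ring

/-- The error of the trapezoidal rule, bounded by a telescoping difference. -/
theorem trapezoid_sub_log_le {x : ℝ} (hx : 0 < x) :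
    (1 / x + 1 / (x + 1)) / 2 - Real.log (1 + 1 / x) ≤
      1 / (8 * x ^ 2) - 1 / (8 * (x + 1) ^ 2) := by
  have h := Real.le_log_one_add_of_nonneg (x := 1 / x) (by positivity)
  have h2 : 2 * (1 / x) / (1 / x + 2) = 2 / (2 * x + 1) := by
    field_simp
    ring
  rw [h2] at h
  have h3 : (1 / x + 1 / (x + 1)) / 2 - 2 / (2 * x + 1) ≤
      1 / (8 * x ^ 2) - 1 / (8 * (x + 1) ^ 2) := by
    rw [← sub_nonneg]
    have : 1 / (8 * x ^ 2) - 1 / (8 * (x + 1) ^ 2) -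
        ((1 / x + 1 / (x + 1)) / 2 - 2 / (2 * x + 1)) =
        1 / (8 * x ^ 2 * (x + 1) ^ 2 * (2 * x + 1)) := by
      field_simp
      ring
    rw [this]
    positivity
  linarith

/-- The error increases along `x, x + 1, x + 2, …`, and tends to zero. -/
theorem digammaError_nonpos {x : ℝ} (hx : 0 < x) : digammaError x ≤ 0 := by
  have hm : Monotone fun k : ℕ => digammaError (x + k) := by
    refine monotone_nat_of_le_succ fun k => ?_
    have hk : 0 < x + (k : ℝ) := by positivity
    have h1 := digammaError_add_one_sub hk
    have h2 := log_one_add_inv_le hk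
    push_cast
    rw [← add_assoc]
    linarith
  simpa using hm.ge_of_tendsto (tendsto_digammaError_add_nat hx) 0

/-- Along `x, x + 1, x + 2, …` the error plus `1 / (8 * x ^ 2)` decreases, and it tends to zero. -/
theorem neg_le_digammaError {x : ℝ} (hx : 0 < x) : -(1 / (8 * x ^ 2)) ≤ digammaError x := by
  have ha : Antitone fun k : ℕ => digammaError (x + k) + 1 / (8 * (x + (k : ℝ)) ^ 2) := by
    refine antitone_nat_of_succ_le fun k => ?_
    have hk : 0 < x + (k : ℝ) := by positivity
    have h1 := digammaError_add_one_sub hk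
    have h2 := trapezoid_sub_log_le hk
    push_cast
    rw [← add_assoc]
    linarith
  have ht : Tendsto (fun k : ℕ => digammaError (x + k) + 1 / (8 * (x + (k : ℝ)) ^ 2)) atTop
      (𝓝 0) := by
    have h1 : Tendsto (fun k : ℕ => x + (k : ℝ)) atTop atTop :=
      tendsto_atTop_add_const_left _ _ tendsto_natCast_atTop_atTop
    have h2 : Tendsto (fun k : ℕ => 1 / (8 * (x + (k : ℝ)) ^ 2)) atTop (𝓝 0) :=
      tendsto_const_nhds.div_atTop
        (((tendsto_pow_atTop two_ne_zero).comp h1).const_mul_atTop (by norm_num))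
    simpa using (tendsto_digammaError_add_nat hx).add h2
  have := ha.le_of_tendsto ht 0
  simp only [Nat.cast_zero, add_zero] at this
  linarith

/-- The mean entropy of the symmetric Dirichlet distribution on `m` states with all parameters
equal to `α / (m * K)`, in closed form. -/
noncomputable def dirichletMeanEntropy (m K α : ℝ) : ℝ :=
  logDeriv Real.Gamma (α / K + 1) - logDeriv Real.Gamma (α / (m * K) + 1)

theorem abs_dirichletMeanEntropy_sub_le {m K α : ℝ} (hm : 0 < m) (hK : 0 < K) (hα : 0 < α) :
    |dirichletMeanEntropy m K α - (Real.log m - K * (m - 1) / (2 * α))| ≤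
      K ^ 2 * (1 + m ^ 2) / (8 * α ^ 2) := by
  have h1 : 0 < α / K := by positivity
  have h2 : 0 < α / (m * K) := by positivity
  have hlog : Real.log m = Real.log (α / K) - Real.log (α / (m * K)) := by
    rw [← Real.log_div h1.ne' h2.ne']
    congr 1
    field_simp
  have e : dirichletMeanEntropy m K α - (Real.log m - K * (m - 1) / (2 * α)) =
      digammaError (α / K) - digammaError (α / (m * K)) := by
    rw [hlog, dirichletMeanEntropy, digammaError, digammaError]
    field_simp
    ring
  have e1 := digammaError_nonpos h1
  have e2 := digammaError_nonpos h2
  have e3 := neg_le_digammaError h1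
  have e4 := neg_le_digammaError h2
  have e5 : K ^ 2 * (1 + m ^ 2) / (8 * α ^ 2) =
      1 / (8 * (α / K) ^ 2) + 1 / (8 * (α / (m * K)) ^ 2) := by
    field_simp
  have p1 : 0 < 1 / (8 * (α / K) ^ 2) := by positivity
  have p2 : 0 < 1 / (8 * (α / (m * K)) ^ 2) := by positivity
  rw [e, e5, abs_le]
  constructor <;> linarith

theorem tendsto_dirichletMeanEntropy {m K : ℝ} (hm : 0 < m) (hK : 0 < K) :
    Tendsto (dirichletMeanEntropy m K) atTop (𝓝 (Real.log m)) := by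
  have h1 : Tendsto (fun α : ℝ => K * (m - 1) / (2 * α)) atTop (𝓝 0) :=
    tendsto_const_nhds.div_atTop (tendsto_id.const_mul_atTop (by norm_num))
  have h2 : Tendsto (fun α : ℝ => K ^ 2 * (1 + m ^ 2) / (8 * α ^ 2)) atTop (𝓝 0) :=
    tendsto_const_nhds.div_atTop ((tendsto_pow_atTop two_ne_zero).const_mul_atTop (by norm_num))
  have h3 : Tendsto (fun α => dirichletMeanEntropy m K α -
      (Real.log m - K * (m - 1) / (2 * α))) atTop (𝓝 0) := by
    refine squeeze_zero_norm' ?_ h2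
    filter_upwards [eventually_gt_atTop 0] with α hα
    exact abs_dirichletMeanEntropy_sub_le hm hK hα
  simpa using h3.add (tendsto_const_nhds.sub h1 : Tendsto _ _ (𝓝 (Real.log m - 0)))

/-- With the same number of states, more rows mean smaller parameters and a smaller mean entropy,
once the equivalent sample size is large. -/
theorem eventually_dirichletMeanEntropy_le {m K L : ℝ} (hm : 1 < m) (hL : 0 < L) (hLK : L ≤ K) :
    ∀ᶠ α in atTop, dirichletMeanEntropy m K α ≤ dirichletMeanEntropy m L α := by
  rcases hLK.eq_or_lt with rfl | hlt
  · simp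
  have hK : 0 < K := hL.trans hlt
  have hg : 0 < (K - L) * (m - 1) := mul_pos (by linarith) (by linarith)
  filter_upwards [eventually_gt_atTop 0,
    eventually_ge_atTop ((K ^ 2 + L ^ 2) * (1 + m ^ 2) / (4 * ((K - L) * (m - 1))))] with α hα hbig
  have h1 := (abs_le.1 (abs_dirichletMeanEntropy_sub_le (by linarith : 0 < m) hK hα)).2
  have h2 := (abs_le.1 (abs_dirichletMeanEntropy_sub_le (by linarith : 0 < m) hL hα)).1
  rw [div_le_iff₀ (by positivity)] at hbig
  have h3 : K ^ 2 * (1 + m ^ 2) / (8 * α ^ 2) + L ^ 2 * (1 + m ^ 2) / (8 * α ^ 2) ≤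
      K * (m - 1) / (2 * α) - L * (m - 1) / (2 * α) := by
    rw [← sub_nonneg]
    have : K * (m - 1) / (2 * α) - L * (m - 1) / (2 * α) -
        (K ^ 2 * (1 + m ^ 2) / (8 * α ^ 2) + L ^ 2 * (1 + m ^ 2) / (8 * α ^ 2)) =
        (α * (4 * ((K - L) * (m - 1))) - (K ^ 2 + L ^ 2) * (1 + m ^ 2)) / (8 * α ^ 2) := by
      field_simp
      ring
    rw [this]
    exact div_nonneg (by linarith) (by positivity)
  linarith

/-- For large `α` the sign of `log (m' / m) + c / α` decides between unequal `m` and `m'`, and for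
`m = m'` the hypothesis says `K' ≤ K`. -/
theorem eventually_dirichletMeanEntropy_le_of_cCoeff {m m' K K' : ℕ} (hm : 2 ≤ m) (hm' : 2 ≤ m')
    (hK : 0 < K) (hK' : 0 < K') :
    ∀ᶠ α : ℝ in atTop,
      0 ≤ Real.log ((m' : ℝ) / m) + α⁻¹ * ((K : ℝ) * cCoeff m - (K' : ℝ) * cCoeff m') →
      dirichletMeanEntropy m K α ≤ dirichletMeanEntropy m' K' α := by
  have hK0 : (0 : ℝ) < K := by exact_mod_cast hK
  have hK0' : (0 : ℝ) < K' := by exact_mod_cast hK'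
  have hm0 : (0 : ℝ) < m := by exact_mod_cast (by omega : 0 < m)
  have hm0' : (0 : ℝ) < m' := by exact_mod_cast (by omega : 0 < m')
  rcases lt_trichotomy m m' with h | rfl | h
  · have hlog : Real.log m < Real.log m' := Real.log_lt_log hm0 (by exact_mod_cast h)
    filter_upwards [(tendsto_dirichletMeanEntropy hm0 hK0).eventually_lt
      (tendsto_dirichletMeanEntropy hm0' hK0') hlog] with α hα _ using hα.le
  · by_cases hKK : K' ≤ K
    · filter_upwards [eventually_dirichletMeanEntropy_le
        (by exact_mod_cast (by omega : 1 < m) : (1 : ℝ) < m) hK0'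
        (Nat.cast_le.2 hKK)] with α hα _ using hα
    · filter_upwards [eventually_gt_atTop 0] with α hα hc
      exfalso
      have hc0 : 0 < cCoeff m := by
        rw [cCoeff]
        positivity
      have hKK' : (K : ℝ) < K' := by exact_mod_cast not_le.1 hKK
      rw [div_self hm0.ne', Real.log_one, zero_add, ← sub_mul] at hc
      have h2 : 0 < α⁻¹ * (((K' : ℝ) - K) * cCoeff m) :=
        mul_pos (inv_pos.2 hα) (mul_pos (by linarith) hc0)
      nlinarith
  · have hlog : Real.log ((m' : ℝ) / m) < 0 :=
      Real.log_neg (by positivity) ((div_lt_one hm0).2 (by exact_mod_cast h))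
    have ht : Tendsto (fun α : ℝ => Real.log ((m' : ℝ) / m) +
        α⁻¹ * ((K : ℝ) * cCoeff m - (K' : ℝ) * cCoeff m')) atTop
        (𝓝 (Real.log ((m' : ℝ) / m))) := by
      simpa using (tendsto_inv_atTop_zero.mul_const
        ((K : ℝ) * cCoeff m - (K' : ℝ) * cCoeff m')).const_add (Real.log ((m' : ℝ) / m))
    filter_upwards [ht.eventually_lt_const hlog] with α hα hc
    exact absurd hc (not_le.2 hα)

end Digamma

/-! ### Moments of the gamma distribution -/

section Gamma

open Filter Topology
open scoped ENNReal

theorem measurable_gammaPDF (a r : ℝ) : Measurable (gammaPDF a r) :=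
  (measurable_gammaPDFReal a r).ennreal_ofReal

theorem lintegral_gammaMeasure (a r : ℝ) {f : ℝ → ℝ≥0∞} (hf : Measurable f) :
    ∫⁻ x, f x ∂gammaMeasure a r = ∫⁻ x, gammaPDF a r x * f x :=
  lintegral_withDensity_eq_lintegral_mul _ (measurable_gammaPDF a r) hf

theorem ae_pos_gammaMeasure (a r : ℝ) : ∀ᵐ x ∂gammaMeasure a r, 0 < x := by
  rw [gammaMeasure, ae_withDensity_iff (measurable_gammaPDF a r)]
  have h0 : ∀ᵐ x : ℝ, x ≠ 0 := Measure.ae_ne volume 0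
  filter_upwards [h0] with x hx hpdf
  by_contra hneg
  exact hpdf (gammaPDF_of_neg (lt_of_le_of_ne (not_lt.1 hneg) hx))

/-- Scaling a gamma variable by `(1 - t)⁻¹` amounts to exponential tilting by `t`. -/
theorem lintegral_comp_mul_gammaMeasure {a t : ℝ} (ht : t < 1) {f : ℝ → ℝ≥0∞}
    (hf : Measurable f) :
    ∫⁻ x, f ((1 - t)⁻¹ * x) ∂gammaMeasure a 1 =
      ∫⁻ x, ENNReal.ofReal ((1 - t) ^ a * Real.exp (t * x)) * f x ∂gammaMeasure a 1 := by
  have hc : 0 < 1 - t := by linarith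
  have hpdf : Measurable (gammaPDF a 1) := measurable_gammaPDF a 1
  rw [lintegral_gammaMeasure a 1 (by fun_prop), lintegral_gammaMeasure a 1 (by fun_prop)]
  have h1 : ∫⁻ x, gammaPDF a 1 x * f ((1 - t)⁻¹ * x) =
      ∫⁻ y, gammaPDF a 1 ((1 - t) * y) * f y
        ∂(Measure.map (fun x => (1 - t)⁻¹ * x) volume) := by
    rw [lintegral_map (by fun_prop) (by fun_prop)]
    refine lintegral_congr fun x => ?_
    rw [mul_inv_cancel_left₀ hc.ne']
  rw [h1, Real.map_volume_mul_left (inv_ne_zero hc.ne'), inv_inv, abs_of_pos hc,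
    lintegral_smul_measure, smul_eq_mul, ← lintegral_const_mul _ (by fun_prop)]
  refine lintegral_congr fun x => ?_
  rw [← mul_assoc, ← mul_assoc]
  congr 1
  rcases lt_or_ge x 0 with hx | hx
  · rw [gammaPDF_of_neg hx, gammaPDF_of_neg (mul_neg_of_pos_of_neg hc hx), mul_zero, zero_mul]
  · rw [gammaPDF_of_nonneg hx, gammaPDF_of_nonneg (mul_nonneg hc.le hx),
      ← ENNReal.ofReal_mul hc.le, ← ENNReal.ofReal_mul' (by positivity)]
    congr 1
    rw [Real.mul_rpow hc.le hx, Real.rpow_sub_one hc.ne',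
      show -(1 * ((1 - t) * x)) = -(1 * x) + t * x by ring, Real.exp_add]
    field_simp

theorem lintegral_exp_gammaMeasure {a t : ℝ} (ha : 0 < a) (ht : t < 1) :
    ∫⁻ x, ENNReal.ofReal (Real.exp (t * x)) ∂gammaMeasure a 1 =
      ENNReal.ofReal ((1 - t) ^ (-a)) := by
  have := isProbabilityMeasure_gammaMeasure ha one_pos
  have hc : 0 < 1 - t := by linarith
  have h := lintegral_comp_mul_gammaMeasure (a := a) ht
    (measurable_const (a := ENNReal.ofReal ((1 - t) ^ (-a))))
  rw [lintegral_const, measure_univ, mul_one] at h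
  rw [h]
  refine lintegral_congr fun x => ?_
  rw [← ENNReal.ofReal_mul (by positivity), mul_right_comm, ← Real.rpow_add hc, add_neg_cancel,
    Real.rpow_zero, one_mul]

/-- Finite measures whose moment generating functions are finite and agree on `(-∞, 1)` are equal:
by the identity theorem their complex moment generating functions agree on the imaginary axis. -/
theorem measure_ext_of_mgf_eq {μ ν : Measure ℝ} [IsFiniteMeasure μ] [IsFiniteMeasure ν]
    (hμ : ∀ t < 1, Integrable (fun x => Real.exp (t * x)) μ)
    (hν : ∀ t < 1, Integrable (fun x => Real.exp (t * x)) ν)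
    (h : ∀ t < 1, mgf id μ t = mgf id ν t) : μ = ν := by
  have hsub : ∀ {ρ : Measure ℝ}, (∀ t < 1, Integrable (fun x => Real.exp (t * x)) ρ) →
      Set.Iio 1 ⊆ interior (integrableExpSet id ρ) := fun hρ =>
    interior_maximal (fun t ht => hρ t ht) isOpen_Iio
  let U : Set ℂ := {z | z.re ∈ Set.Iio (1 : ℝ)}
  have hX : AnalyticOnNhd ℂ (complexMGF id μ) U :=
    analyticOnNhd_complexMGF.mono fun z hz => hsub hμ hz
  have hY : AnalyticOnNhd ℂ (complexMGF id ν) U :=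
    analyticOnNhd_complexMGF.mono fun z hz => hsub hν hz
  have hU : IsPreconnected U := ((convex_Iio (1 : ℝ)).linear_preimage Complex.reLm).isPreconnected
  have hfreq : ∃ᶠ z in 𝓝[≠] (0 : ℂ), complexMGF id μ z = complexMGF id ν z := by
    have ht : Tendsto (fun x : ℝ => (x : ℂ)) (𝓝[≠] 0) (𝓝[≠] 0) := by
      refine tendsto_nhdsWithin_iff.2 ⟨?_, ?_⟩
      · exact (Complex.continuous_ofReal.tendsto' 0 0 Complex.ofReal_zero).mono_left
          nhdsWithin_le_nhds
      · filter_upwards [self_mem_nhdsWithin] with x hx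
        simpa using hx
    refine ht.frequently (Eventually.frequently ?_)
    filter_upwards [nhdsWithin_le_nhds (gt_mem_nhds (zero_lt_one (α := ℝ)))] with x hx
    rw [complexMGF_ofReal, complexMGF_ofReal, h x hx]
  have heq := hX.eqOn_of_preconnected_of_frequently_eq hY hU (z₀ := 0) (by simp [U]) hfreq
  refine Measure.ext_of_charFun (funext fun t => ?_)
  rw [← complexMGF_id_mul_I, ← complexMGF_id_mul_I]
  exact heq (by simp [U])

/-- A gamma distribution is determined, up to a factor, by its moment generating function. -/
theorem eq_smul_gammaMeasure {s : ℝ} (hs : 0 < s) {ρ : Measure ℝ} {C : ℝ≥0∞} (hC : C ≠ ∞)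
    (h : ∀ t < 1, ∫⁻ x, ENNReal.ofReal (Real.exp (t * x)) ∂ρ =
      C * ENNReal.ofReal ((1 - t) ^ (-s))) :
    ρ = C • gammaMeasure s 1 := by
  have := isProbabilityMeasure_gammaMeasure hs one_pos
  have h' : ∀ t < 1, ∫⁻ x, ENNReal.ofReal (Real.exp (t * x)) ∂(C • gammaMeasure s 1) =
      C * ENNReal.ofReal ((1 - t) ^ (-s)) := fun t ht => by
    rw [lintegral_smul_measure, lintegral_exp_gammaMeasure hs ht, smul_eq_mul]
  have hfin : ∀ t : ℝ, C * ENNReal.ofReal ((1 - t) ^ (-s)) ≠ ∞ := fun t =>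
    ENNReal.mul_ne_top hC ENNReal.ofReal_ne_top
  have : IsFiniteMeasure ρ := ⟨by
    have h0 := h 0 one_pos
    simp only [zero_mul, Real.exp_zero, ENNReal.ofReal_one, lintegral_one] at h0
    rw [h0]
    exact (hfin 0).lt_top⟩
  have : IsFiniteMeasure (C • gammaMeasure s 1) := Measure.smul_finite _ hC
  have hint : ∀ {σ : Measure ℝ}, (∀ t < 1, ∫⁻ x, ENNReal.ofReal (Real.exp (t * x)) ∂σ =
      C * ENNReal.ofReal ((1 - t) ^ (-s))) → ∀ t < 1, Integrable (fun x => Real.exp (t * x)) σ := by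
    intro σ hσ t ht
    refine (lintegral_ofReal_ne_top_iff_integrable (by fun_prop)
      (ae_of_all _ fun x => (Real.exp_pos _).le)).1 ?_
    rw [hσ t ht]
    exact hfin t
  have hmgf : ∀ {σ : Measure ℝ} (t : ℝ),
      mgf id σ t = (∫⁻ x, ENNReal.ofReal (Real.exp (t * x)) ∂σ).toReal := fun t =>
    integral_eq_lintegral_of_nonneg_ae (ae_of_all _ fun x => (Real.exp_pos _).le) (by fun_prop)
  refine measure_ext_of_mgf_eq (hint h) (hint h') fun t ht => ?_
  rw [hmgf, hmgf, h t ht, h' t ht]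

theorem lintegral_exp_mul_log_gammaMeasure {a t : ℝ} (ha : 0 < a) (ht : 0 < a + t) :
    ∫⁻ x, ENNReal.ofReal (Real.exp (t * Real.log x)) ∂gammaMeasure a 1 =
      ENNReal.ofReal (Real.Gamma (a + t) / Real.Gamma a) := by
  have hΓ := Real.Gamma_pos_of_pos ha
  have hΓt := Real.Gamma_pos_of_pos ht
  rw [lintegral_gammaMeasure a 1 (by fun_prop)]
  have h1 : ∫⁻ x, gammaPDF a 1 x * ENNReal.ofReal (Real.exp (t * Real.log x)) =
      ∫⁻ x, ENNReal.ofReal (Real.Gamma (a + t) / Real.Gamma a) * gammaPDF (a + t) 1 x := by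
    refine lintegral_congr_ae ?_
    filter_upwards [Measure.ae_ne volume (0 : ℝ)] with x hx0
    rcases lt_or_gt_of_ne hx0 with hx | hx
    · rw [gammaPDF_of_neg hx, gammaPDF_of_neg hx, mul_zero, zero_mul]
    · rw [gammaPDF_of_nonneg hx.le, gammaPDF_of_nonneg hx.le, ← ENNReal.ofReal_mul (by positivity),
        ← ENNReal.ofReal_mul (by positivity)]
      congr 1
      rw [mul_comm t, ← Real.rpow_def_of_pos hx, show a + t - 1 = a - 1 + t by ring,
        Real.rpow_add hx, Real.one_rpow, Real.one_rpow]
      field_simp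
  rw [h1, lintegral_const_mul _ (measurable_gammaPDF (a + t) 1),
    lintegral_gammaPDF_eq_one ht one_pos, mul_one]

theorem integrable_exp_mul_log_gammaMeasure {a t : ℝ} (ha : 0 < a) (ht : 0 < a + t) :
    Integrable (fun x => Real.exp (t * Real.log x)) (gammaMeasure a 1) := by
  refine (lintegral_ofReal_ne_top_iff_integrable (by fun_prop)
    (ae_of_all _ fun x => (Real.exp_pos _).le)).1 ?_
  rw [lintegral_exp_mul_log_gammaMeasure ha ht]
  exact ENNReal.ofReal_ne_top

/-- The Mellin transform of the gamma distribution is the moment generating function of the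
logarithm of a gamma variable. -/
theorem mgf_log_gammaMeasure {a t : ℝ} (ha : 0 < a) (ht : 0 < a + t) :
    mgf Real.log (gammaMeasure a 1) t = Real.Gamma (a + t) / Real.Gamma a := by
  have hΓ := Real.Gamma_pos_of_pos ha
  have hΓt := Real.Gamma_pos_of_pos ht
  rw [mgf, integral_eq_lintegral_of_nonneg_ae (ae_of_all _ fun x => (Real.exp_pos _).le)
    (by fun_prop), lintegral_exp_mul_log_gammaMeasure ha ht, ENNReal.toReal_ofReal (by positivity)]

theorem one_mem_interior_integrableExpSet_log {a : ℝ} (ha : 0 < a) :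
    1 ∈ interior (integrableExpSet Real.log (gammaMeasure a 1)) := by
  refine interior_maximal (t := Set.Ioi (-a)) (fun t ht => ?_) isOpen_Ioi ?_
  · refine integrable_exp_mul_log_gammaMeasure ha ?_
    have : -a < t := ht
    linarith
  · simp only [Set.mem_Ioi]
    linarith

theorem ae_mul_log_gammaMeasure (a : ℝ) :
    (fun x => Real.log x * Real.exp (1 * Real.log x)) =ᵐ[gammaMeasure a 1]
      fun x => x * Real.log x := by
  filter_upwards [ae_pos_gammaMeasure a 1] with x hx
  rw [one_mul, Real.exp_log hx, mul_comm]

theorem integrable_mul_log_gammaMeasure {a : ℝ} (ha : 0 < a) :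
    Integrable (fun x => x * Real.log x) (gammaMeasure a 1) := by
  have h := integrable_pow_mul_exp_of_mem_interior_integrableExpSet
    (one_mem_interior_integrableExpSet_log ha) 1
  simp only [pow_one] at h
  exact h.congr (ae_mul_log_gammaMeasure a)

theorem integral_mul_log_gammaMeasure {a : ℝ} (ha : 0 < a) :
    ∫ x, x * Real.log x ∂gammaMeasure a 1 = a * logDeriv Real.Gamma (a + 1) := by
  have h1 := hasDerivAt_mgf (one_mem_interior_integrableExpSet_log ha)
  have h2 : HasDerivAt (fun t => Real.Gamma (a + t) / Real.Gamma a)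
      (deriv Real.Gamma (a + 1) / Real.Gamma a) 1 :=
    ((differentiableAt_Gamma_of_pos (by linarith : 0 < a + 1)).hasDerivAt.comp_const_add
      a 1).div_const _
  have h3 : mgf Real.log (gammaMeasure a 1) =ᶠ[𝓝 1]
      fun t => Real.Gamma (a + t) / Real.Gamma a := by
    filter_upwards [lt_mem_nhds (by linarith : -a < 1)] with t ht
    exact mgf_log_gammaMeasure ha (by linarith)
  rw [← integral_congr_ae (ae_mul_log_gammaMeasure a), h1.unique (h2.congr_of_eventuallyEq h3),
    logDeriv_apply, Real.Gamma_add_one ha.ne']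
  have := (Real.Gamma_pos_of_pos ha).ne'
  field_simp

theorem lintegral_ofReal_gammaMeasure {a : ℝ} (ha : 0 < a) :
    ∫⁻ x, ENNReal.ofReal x ∂gammaMeasure a 1 = ENNReal.ofReal a := by
  have h := lintegral_exp_mul_log_gammaMeasure ha (by linarith : 0 < a + 1)
  rw [Real.Gamma_add_one ha.ne', mul_div_cancel_right₀ _ (Real.Gamma_pos_of_pos ha).ne'] at h
  rw [← h]
  refine lintegral_congr_ae ?_
  filter_upwards [ae_pos_gammaMeasure a 1] with x hx
  rw [one_mul, Real.exp_log hx]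

end Gamma

/-! ### The mean entropy of a Dirichlet distribution -/

section Dirichlet

open scoped ENNReal

variable {m : ℕ} {a : Fin m → ℝ}

theorem isProbabilityMeasure_pi_gammaMeasure (ha : ∀ k, 0 < a k) :
    IsProbabilityMeasure (Measure.pi fun k => gammaMeasure (a k) 1) :=
  have := fun k => isProbabilityMeasure_gammaMeasure (ha k) one_pos
  inferInstance

theorem lintegral_prod_pi_gammaMeasure (ha : ∀ k, 0 < a k) {f : Fin m → ℝ → ℝ≥0∞}
    (hf : ∀ k, Measurable (f k)) :
    ∫⁻ g, ∏ k, f k (g k) ∂Measure.pi (fun k => gammaMeasure (a k) 1) =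
      ∏ k, ∫⁻ x, f k x ∂gammaMeasure (a k) 1 := by
  have := fun k => isProbabilityMeasure_gammaMeasure (ha k) one_pos
  have hind := iIndepFun_pi (μ := fun k => gammaMeasure (a k) 1) (X := f)
    fun k => (hf k).aemeasurable
  have h := lintegral_prod_eq_prod_lintegral_of_indepFun Finset.univ _ hind
    fun k => (hf k).comp (measurable_pi_apply k)
  rw [h]
  exact Finset.prod_congr rfl fun k _ => (measurePreserving_eval _ k).lintegral_comp (hf k)

/-- Scaling independent gamma variables by `(1 - t)⁻¹` tilts their joint law by `exp (t * S)`, where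
`S` is their sum. -/
theorem map_mul_pi_gammaMeasure (ha : ∀ k, 0 < a k) {t : ℝ} (ht : t < 1) :
    (Measure.pi fun k => gammaMeasure (a k) 1).map (fun g k => (1 - t)⁻¹ * g k) =
      (Measure.pi fun k => gammaMeasure (a k) 1).withDensity
        fun g => ENNReal.ofReal ((1 - t) ^ (∑ k, a k) * Real.exp (t * ∑ k, g k)) := by
  have hP := fun k => isProbabilityMeasure_gammaMeasure (ha k) one_pos
  have hP' := fun k => Measure.isProbabilityMeasure_map (μ := gammaMeasure (a k) 1)
    (f := fun x => (1 - t)⁻¹ * x) (by fun_prop)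
  have hc : 0 < 1 - t := by linarith
  rw [Measure.pi_map_pi (f := fun _ x => (1 - t)⁻¹ * x) (fun k => by fun_prop)]
  refine Measure.pi_eq fun s hs => ?_
  have hone : ∀ k, ((gammaMeasure (a k) 1).map fun x => (1 - t)⁻¹ * x) (s k) =
      ∫⁻ x, ENNReal.ofReal ((1 - t) ^ a k * Real.exp (t * x)) * (s k).indicator 1 x
        ∂gammaMeasure (a k) 1 := fun k => by
    rw [← lintegral_comp_mul_gammaMeasure ht (measurable_one.indicator (hs k)),
      ← lintegral_map (f := (s k).indicator 1) (measurable_one.indicator (hs k)) (by fun_prop),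
      lintegral_indicator_one (hs k)]
  rw [Finset.prod_congr rfl fun k _ => hone k, ← lintegral_prod_pi_gammaMeasure ha
    (f := fun k x => ENNReal.ofReal ((1 - t) ^ a k * Real.exp (t * x)) * (s k).indicator 1 x)
    fun k => Measurable.mul (by fun_prop) (measurable_one.indicator (hs k)),
    withDensity_apply _ (MeasurableSet.univ_pi hs),
    ← lintegral_indicator (MeasurableSet.univ_pi hs)]
  refine lintegral_congr fun g => ?_
  by_cases hg : g ∈ Set.univ.pi s
  · rw [Set.indicator_of_mem hg, Real.rpow_sum_of_pos hc, Finset.mul_sum, Real.exp_sum,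
      ← Finset.prod_mul_distrib, ENNReal.ofReal_prod_of_nonneg fun k _ => by positivity]
    refine Finset.prod_congr rfl fun k _ => ?_
    rw [Set.indicator_of_mem (hg k trivial), Pi.one_apply, mul_one]
  · rw [Set.indicator_of_notMem hg]
    simp only [Set.mem_univ_pi, not_forall] at hg
    obtain ⟨k, hk⟩ := hg
    refine (Finset.prod_eq_zero (Finset.mem_univ k) ?_).symm
    rw [Set.indicator_of_notMem hk, mul_zero]

/-- The sum `S` of independent gamma variables is a gamma variable, independent of every function
`h` of the variables that is invariant under scaling: the law of `S` weighted by `h` is the mean of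
`h` times the law of `S`. Tilting by `exp (t * S)` is a scaling, so the weighted law of `S` has a
gamma moment generating function. -/
theorem map_sum_withDensity_pi_gammaMeasure (ha : ∀ k, 0 < a k) (hs : 0 < ∑ k, a k)
    {h : (Fin m → ℝ) → ℝ≥0∞} (hm : Measurable h)
    (hh : ∀ c : ℝ, 0 < c → ∀ g, h (fun k => c * g k) = h g)
    (hfin : ∫⁻ g, h g ∂Measure.pi (fun k => gammaMeasure (a k) 1) ≠ ∞) :
    ((Measure.pi fun k => gammaMeasure (a k) 1).withDensity h).map (fun g => ∑ k, g k) =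
      (∫⁻ g, h g ∂Measure.pi (fun k => gammaMeasure (a k) 1)) •
        gammaMeasure (∑ k, a k) 1 := by
  refine eq_smul_gammaMeasure hs hfin fun t ht => ?_
  have hc : 0 < 1 - t := by linarith
  have h1 : ∫⁻ g, h g ∂Measure.pi (fun k => gammaMeasure (a k) 1) =
      ∫⁻ g, h g ∂(Measure.pi fun k => gammaMeasure (a k) 1).map
        (fun g k => (1 - t)⁻¹ * g k) := by
    rw [lintegral_map hm (by fun_prop)]
    exact lintegral_congr fun g => (hh _ (inv_pos.2 hc) g).symm
  rw [lintegral_map (by fun_prop) (by fun_prop),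
    lintegral_withDensity_eq_lintegral_mul _ hm (by fun_prop), h1, map_mul_pi_gammaMeasure ha ht,
    lintegral_withDensity_eq_lintegral_mul _ (by fun_prop) hm,
    ← lintegral_mul_const _ (by fun_prop)]
  refine lintegral_congr fun g => ?_
  simp only [Pi.mul_apply]
  rw [mul_comm (h g), mul_right_comm, ← ENNReal.ofReal_mul (by positivity), mul_right_comm,
    ← Real.rpow_add hc, add_neg_cancel, Real.rpow_zero, one_mul]

theorem map_sum_pi_gammaMeasure (ha : ∀ k, 0 < a k) (hs : 0 < ∑ k, a k) :
    (Measure.pi fun k => gammaMeasure (a k) 1).map (fun g => ∑ k, g k) =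
      gammaMeasure (∑ k, a k) 1 := by
  have := isProbabilityMeasure_pi_gammaMeasure ha
  have h := map_sum_withDensity_pi_gammaMeasure ha hs (h := 1) measurable_one
    (fun _ _ _ => rfl) (by simp)
  simpa using h

theorem ae_pos_pi_gammaMeasure (ha : ∀ k, 0 < a k) :
    ∀ᵐ g ∂Measure.pi (fun k => gammaMeasure (a k) 1), ∀ k, 0 < g k := by
  have := fun k => isProbabilityMeasure_gammaMeasure (ha k) one_pos
  exact ae_all_iff.2 fun k =>
    (measurePreserving_eval (fun k => gammaMeasure (a k) 1) k).quasiMeasurePreserving.ae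
      (ae_pos_gammaMeasure (a k) 1)

theorem measurable_shannonEntropy : Measurable (shannonEntropy (m := m)) := by
  unfold shannonEntropy
  exact Finset.measurable_sum _ fun k _ =>
    Real.continuous_negMulLog.measurable.comp (measurable_pi_apply k)

theorem shannonEntropy_nonneg {p : Fin m → ℝ} (h0 : ∀ k, 0 ≤ p k) (h1 : ∀ k, p k ≤ 1) :
    0 ≤ shannonEntropy p :=
  Finset.sum_nonneg fun k _ => Real.negMulLog_nonneg (h0 k) (h1 k)

theorem shannonEntropy_le {p : Fin m → ℝ} (h0 : ∀ k, 0 ≤ p k) :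
    shannonEntropy p ≤ m := by
  calc shannonEntropy p ≤ ∑ _k : Fin m, (1 : ℝ) :=
        Finset.sum_le_sum fun k _ => (Real.negMulLog_le_one_sub_self (h0 k)).trans (by
          linarith [h0 k])
    _ = m := by simp

theorem shannonEntropy_normalize_mul_sum {g : Fin m → ℝ} (hg : ∀ k, 0 < g k)
    (hS : 0 < ∑ k, g k) :
    shannonEntropy (fun k => g k / ∑ l, g l) * ∑ l, g l =
      (∑ l, g l) * Real.log (∑ l, g l) - ∑ k, g k * Real.log (g k) := by
  rw [shannonEntropy, Finset.sum_mul]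
  have h : ∀ k, Real.negMulLog (g k / ∑ l, g l) * ∑ l, g l =
      g k * Real.log (∑ l, g l) - g k * Real.log (g k) := fun k => by
    rw [Real.negMulLog, Real.log_div (hg k).ne' hS.ne']
    field_simp
    ring
  rw [Finset.sum_congr rfl fun k _ => h k, Finset.sum_sub_distrib, Finset.sum_mul]

/-- The mean of `H * S`, where `H` is the entropy of the normalized gamma variables and `S` their
sum, is computed twice: by independence of `H` and `S`, and from
`H * S = S log S - ∑ k, g k log (g k)`. -/
theorem integral_shannonEntropy_dirichletMeasure (ha : ∀ k, 0 < a k) (hs : 0 < ∑ k, a k) :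
    ∫ p, shannonEntropy p ∂dirichletMeasure a =
      logDeriv Real.Gamma (∑ k, a k + 1) -
        ∑ k, a k / (∑ l, a l) * logDeriv Real.Gamma (a k + 1) := by
  have hP := fun k => isProbabilityMeasure_gammaMeasure (ha k) one_pos
  set μ := Measure.pi fun k => gammaMeasure (a k) 1 with hμ
  set s := ∑ k, a k with hs_def
  let N : (Fin m → ℝ) → Fin m → ℝ := fun g k => g k / ∑ l, g l
  have hN : Measurable N := by fun_prop
  have hpos : ∀ᵐ g ∂μ, ∀ k, 0 < g k := ae_pos_pi_gammaMeasure ha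
  have hne : Nonempty (Fin m) := by
    by_contra hcon
    rw [not_nonempty_iff] at hcon
    simp [hs_def] at hs
  have hSpos : ∀ {g : Fin m → ℝ}, (∀ k, 0 < g k) → 0 < ∑ k, g k := fun hg =>
    Finset.sum_pos (fun k _ => hg k) Finset.univ_nonempty
  have hN0 : ∀ {g : Fin m → ℝ}, (∀ k, 0 < g k) → ∀ k, 0 ≤ N g k := fun hg k =>
    div_nonneg (hg k).le (hSpos hg).le
  have hN1 : ∀ {g : Fin m → ℝ}, (∀ k, 0 < g k) → ∀ k, N g k ≤ 1 := fun hg k =>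
    div_le_one_of_le₀ (Finset.single_le_sum (fun l _ => (hg l).le) (Finset.mem_univ k))
      (hSpos hg).le
  have hH0 : ∀ᵐ g ∂μ, 0 ≤ shannonEntropy (N g) := by
    filter_upwards [hpos] with g hg using shannonEntropy_nonneg (hN0 hg) (hN1 hg)
  let h : (Fin m → ℝ) → ℝ≥0∞ := fun g => ENNReal.ofReal (shannonEntropy (N g))
  have hHm : AEStronglyMeasurable (fun g => shannonEntropy (N g)) μ :=
    (measurable_shannonEntropy.comp hN).aestronglyMeasurable
  have hHSm : AEStronglyMeasurable (fun g => shannonEntropy (N g) * ∑ k, g k) μ :=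
    hHm.mul (by fun_prop)
  have hm : Measurable h := (measurable_shannonEntropy.comp hN).ennreal_ofReal
  have hfin : ∫⁻ g, h g ∂μ ≠ ∞ := by
    have hle : ∫⁻ g, h g ∂μ ≤ ∫⁻ _, ENNReal.ofReal m ∂μ := by
      refine lintegral_mono_ae ?_
      filter_upwards [hpos] with g hg
      exact ENNReal.ofReal_le_ofReal (shannonEntropy_le (hN0 hg))
    rw [lintegral_const, measure_univ, mul_one] at hle
    exact (hle.trans_lt ENNReal.ofReal_lt_top).ne
  have hhom : ∀ c : ℝ, 0 < c → ∀ g, h (fun k => c * g k) = h g := by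
    intro c hc g
    have : N (fun k => c * g k) = N g := by
      funext k
      simp only [N]
      rw [← Finset.mul_sum, mul_div_mul_left _ _ hc.ne']
    simp only [h, this]
  have hsplit : ∫ g, shannonEntropy (N g) * ∑ k, g k ∂μ = (∫ g, shannonEntropy (N g) ∂μ) * s := by
    have e1 : ∫⁻ g, h g * ENNReal.ofReal (∑ k, g k) ∂μ =
        (∫⁻ g, h g ∂μ) * ENNReal.ofReal s := by
      have := congrArg (fun ρ : Measure ℝ => ∫⁻ x, ENNReal.ofReal x ∂ρ)
        (map_sum_withDensity_pi_gammaMeasure ha hs hm hhom hfin)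
      rw [lintegral_map (by fun_prop) (by fun_prop),
        lintegral_withDensity_eq_lintegral_mul _ hm (by fun_prop), lintegral_smul_measure,
        lintegral_ofReal_gammaMeasure hs, smul_eq_mul] at this
      exact this
    rw [integral_eq_lintegral_of_nonneg_ae hH0 hHm,
      integral_eq_lintegral_of_nonneg_ae _ hHSm]
    · rw [← ENNReal.toReal_ofReal hs.le, ← ENNReal.toReal_mul, ← e1]
      congr 1
      refine lintegral_congr_ae ?_
      filter_upwards [hH0] with g hg using ENNReal.ofReal_mul hg
    · filter_upwards [hH0, hpos] with g h1 h2 using mul_nonneg h1 (hSpos h2).le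
  have hSlaw : MeasurePreserving (fun g : Fin m → ℝ => ∑ k, g k) μ (gammaMeasure s 1) :=
    ⟨by fun_prop, map_sum_pi_gammaMeasure ha hs⟩
  have hmeas : ∀ b : ℝ, AEStronglyMeasurable (fun x : ℝ => x * Real.log x) (gammaMeasure b 1) :=
    fun b => by fun_prop
  have hSint : Integrable (fun g : Fin m → ℝ => (∑ k, g k) * Real.log (∑ k, g k)) μ :=
    (hSlaw.integrable_comp (hmeas s)).2 (integrable_mul_log_gammaMeasure hs)
  have hkint : ∀ k, Integrable (fun g : Fin m → ℝ => g k * Real.log (g k)) μ := fun k =>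
    ((measurePreserving_eval (fun k => gammaMeasure (a k) 1) k).integrable_comp (hmeas _)).2
      (integrable_mul_log_gammaMeasure (ha k))
  have hSval : ∫ g, (∑ k, g k) * Real.log (∑ k, g k) ∂μ = s * logDeriv Real.Gamma (s + 1) := by
    rw [← integral_mul_log_gammaMeasure hs, ← hSlaw.map_eq,
      integral_map hSlaw.measurable.aemeasurable (by fun_prop)]
  have hkval : ∀ k, ∫ g, g k * Real.log (g k) ∂μ = a k * logDeriv Real.Gamma (a k + 1) := by
    intro k
    have hk := measurePreserving_eval (fun k => gammaMeasure (a k) 1) k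
    rw [← integral_mul_log_gammaMeasure (ha k), ← hk.map_eq,
      integral_map hk.measurable.aemeasurable (by fun_prop)]
  have hval : ∫ g, shannonEntropy (N g) * ∑ k, g k ∂μ =
      s * logDeriv Real.Gamma (s + 1) - ∑ k, a k * logDeriv Real.Gamma (a k + 1) := by
    rw [← hSval, ← Finset.sum_congr rfl fun k _ => hkval k,
      ← integral_finsetSum _ fun k _ => hkint k,
      ← integral_sub hSint (integrable_finsetSum _ fun k _ => hkint k)]
    refine integral_congr_ae ?_
    filter_upwards [hpos] with g hg using shannonEntropy_normalize_mul_sum hg (hSpos hg)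
  rw [dirichletMeasure, integral_map hN.aemeasurable measurable_shannonEntropy.aestronglyMeasurable]
  refine mul_right_cancel₀ hs.ne' (hsplit.symm.trans (hval.trans ?_))
  rw [sub_mul, Finset.sum_mul (a := s), mul_comm s]
  congr 1
  refine Finset.sum_congr rfl fun k _ => ?_
  field_simp

theorem integral_shannonEntropy_symmetric_dirichletMeasure {K α : ℝ} (hm : 0 < m) (hK : 0 < K)
    (hα : 0 < α) :
    ∫ p, shannonEntropy p ∂dirichletMeasure (fun _ : Fin m => α / ((m : ℝ) * K)) =
      dirichletMeanEntropy m K α := by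
  have hm' : (0 : ℝ) < m := by exact_mod_cast hm
  have hs : ∑ _k : Fin m, α / ((m : ℝ) * K) = α / K := by
    rw [Finset.sum_const, Finset.card_univ, Fintype.card_fin, nsmul_eq_mul]
    field_simp
  rw [integral_shannonEntropy_dirichletMeasure (fun _ => by positivity) (by rw [hs]; positivity),
    hs, dirichletMeanEntropy]
  congr 1
  rw [Finset.sum_const, Finset.card_univ, Fintype.card_fin, nsmul_eq_mul]
  field_simp

end Dirichlet

/-! ### The joint law of a structural causal model -/

namespace DiscreteSCM

variable {d : ℕ} {G : DAG d} {n : Fin d → ℕ}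

/-- The solution of the structural equations after the intervention `do(X_i = k)`, which replaces
the mechanism of node `i` by the constant `k`. -/
noncomputable def solveDo (M : DiscreteSCM.{v} G n) (i : Fin d) (k : Fin (n i))
    (u : ∀ j, M.Noise j) : ∀ j, Fin (n j) :=
  G.wellFounded_parents.fix fun j x =>
    Function.update M.mech i (fun _ _ => k) j (fun l => x l.1 l.2) (u j)

theorem solveDo_apply (M : DiscreteSCM.{v} G n) (i : Fin d) (k : Fin (n i)) (u : ∀ j, M.Noise j)
    (j : Fin d) : M.solveDo i k u j =
      Function.update M.mech i (fun _ _ => k) j (G.config n j (M.solveDo i k u)) (u j) :=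
  G.wellFounded_parents.fix_eq _ j

theorem solveDo_self (M : DiscreteSCM.{v} G n) (i : Fin d) (k : Fin (n i)) (u : ∀ j, M.Noise j) :
    M.solveDo i k u i = k := by
  rw [solveDo_apply, Function.update_self]

theorem solveDo_of_ne (M : DiscreteSCM.{v} G n) (i : Fin d) (k : Fin (n i)) (u : ∀ j, M.Noise j)
    {j : Fin d} (hj : j ≠ i) :
    M.solveDo i k u j = M.mech j (G.config n j (M.solveDo i k u)) (u j) := by
  rw [solveDo_apply, Function.update_of_ne hj]

/-- The modified structural equations have only one solution. -/
theorem solveDo_eq_iff (M : DiscreteSCM.{v} G n) (i : Fin d) (k : Fin (n i))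
    (u : ∀ j, M.Noise j) (x : ∀ j, Fin (n j)) :
    M.solveDo i k u = x ↔ x i = k ∧ ∀ j, j ≠ i → M.mech j (G.config n j x) (u j) = x j := by
  constructor
  · rintro rfl
    exact ⟨M.solveDo_self i k u, fun j hj => (M.solveDo_of_ne i k u hj).symm⟩
  · rintro ⟨hi, h⟩
    funext j
    induction j using G.wellFounded_parents.induction with
    | _ j ih =>
      rcases eq_or_ne j i with rfl | hj
      · rw [solveDo_self, hi]
      · rw [M.solveDo_of_ne i k u hj, ← h j hj]
        congr 1
        exact funext fun l => ih l.1 l.2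

/-- An intervention at `i` changes only `i` and its descendants. -/
theorem solveDo_of_not_descendant (M : DiscreteSCM.{v} G n) (i : Fin d) (k : Fin (n i))
    (u : ∀ j, M.Noise j) (j : Fin d) (hne : j ≠ i)
    (hj : ¬ Relation.TransGen (fun a b => a ∈ G.parents b) i j) :
    M.solveDo i k u j = M.solve u j := by
  induction j using G.wellFounded_parents.induction with
  | _ j ih =>
    rw [M.solveDo_of_ne i k u hne, solve_apply]
    congr 1
    funext l
    refine ih l.1 l.2 ?_ fun h => hj (h.tail l.2)
    intro hl
    exact hj (.single (hl ▸ l.2))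

theorem config_solveDo (M : DiscreteSCM.{v} G n) (i : Fin d) (k : Fin (n i))
    (u : ∀ j, M.Noise j) : G.config n i (M.solveDo i k u) = G.config n i (M.solve u) := by
  funext l
  refine M.solveDo_of_not_descendant i k u l.1 ?_ fun h => G.acyclic i (h.tail l.2)
  intro hl
  have h := l.2
  rw [hl] at h
  exact G.acyclic i (.single h)

/-- The probability of the parent configuration `y` of node `i`, as a polynomial in the tables `θ`
of the other nodes: the sum of the probabilities of the joint states `x` over `y` after the
intervention `X_i = k₀`, which has no effect on the parents of `i`. -/
def parentWeight (G : DAG d) (n : Fin d → ℕ) (i : Fin d) (k₀ : Fin (n i)) (y : G.Config n i)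
    (θ : ∀ j : (Finset.univ.erase i : Finset (Fin d)), G.Config n j → Fin (n j) → ℝ) : ℝ :=
  ∑ x : ∀ j, Fin (n j) with x i = k₀ ∧ G.config n i x = y,
    ∏ j : (Finset.univ.erase i : Finset (Fin d)), θ j (G.config n j x) (x j)

theorem measurable_parentWeight (G : DAG d) (n : Fin d → ℕ) (i : Fin d) (k₀ : Fin (n i))
    (y : G.Config n i) : Measurable (parentWeight G n i k₀ y) := by
  unfold parentWeight
  fun_prop

theorem measurableSet_mech_preimage (M : DiscreteSCM.{v} G n) (i : Fin d) (y : G.Config n i)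
    (k : Fin (n i)) : MeasurableSet (M.mech i y ⁻¹' {k}) :=
  M.measurable_mech i y (measurableSet_singleton k)

instance isProbabilityMeasure_law (M : DiscreteSCM.{v} G n) : IsProbabilityMeasure M.law :=
  Measure.isProbabilityMeasure_map M.measurable_solve.aemeasurable

/-- The event that node `i` has the value `k` and its parents the configuration `y` is the disjoint
union, over the joint states `x` with `x i = k₀` that extend `y`, of the boxes of noise values that
produce `x` under the intervention `X_i = k₀` and produce `k` at `i` from `y`. -/
theorem law_real_config_inter (M : DiscreteSCM.{v} G n) (i : Fin d) (k₀ k : Fin (n i))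
    (y : G.Config n i) :
    M.law.real (G.config n i ⁻¹' {y} ∩ (fun x => x i) ⁻¹' {k}) =
      parentWeight G n i k₀ y (fun j => M.cpt j) * M.cpt i y k := by
  classical
  -- the side of the box of `x` at node `j`
  let B : (∀ j, Fin (n j)) → ∀ j, Set (M.Noise j) := fun x =>
    Function.update (fun j => M.mech j (G.config n j x) ⁻¹' {x j}) i (M.mech i y ⁻¹' {k})
  have hBi : ∀ x, B x i = M.mech i y ⁻¹' {k} := fun x => Function.update_self ..
  have hBj : ∀ x j, j ≠ i → B x j = M.mech j (G.config n j x) ⁻¹' {x j} :=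
    fun x j hj => Function.update_of_ne hj ..
  have hBm : ∀ x j, MeasurableSet (B x j) := by
    intro x j
    rcases eq_or_ne j i with rfl | hj
    · rw [hBi]
      exact M.measurableSet_mech_preimage _ _ _
    · rw [hBj x j hj]
      exact M.measurableSet_mech_preimage _ _ _
  let T : Finset (∀ j, Fin (n j)) := {x | x i = k₀ ∧ G.config n i x = y}
  have hmem : ∀ x ∈ T, ∀ u, u ∈ Set.univ.pi (B x) ↔
      M.solveDo i k₀ u = x ∧ M.mech i y (u i) = k := by
    intro x hx u
    have hx' : x i = k₀ ∧ G.config n i x = y := by simpa [T] using hx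
    rw [solveDo_eq_iff]
    constructor
    · intro hu
      refine ⟨⟨hx'.1, fun j hj => ?_⟩, by simpa [hBi] using hu i trivial⟩
      simpa [hBj x j hj] using hu j trivial
    · rintro ⟨⟨-, h1⟩, h2⟩ j -
      rcases eq_or_ne j i with rfl | hj
      · simpa [hBi] using h2
      · simpa [hBj x j hj] using h1 j hj
  have hset : M.solve ⁻¹' (G.config n i ⁻¹' {y} ∩ (fun x => x i) ⁻¹' {k}) =
      ⋃ x ∈ T, Set.univ.pi (B x) := by
    ext u
    simp only [Set.mem_iUnion]
    constructor
    · rintro ⟨h1, h2⟩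
      have h1' : G.config n i (M.solve u) = y := h1
      have h2' : M.solve u i = k := h2
      have hT : M.solveDo i k₀ u ∈ T := by
        simp only [T, Finset.mem_filter, Finset.mem_univ, true_and]
        exact ⟨M.solveDo_self i k₀ u, (M.config_solveDo i k₀ u).trans h1'⟩
      refine ⟨_, hT, (hmem _ hT u).2 ⟨rfl, ?_⟩⟩
      rw [← h1', ← solve_apply, h2']
    · rintro ⟨x, hx, hu⟩
      obtain ⟨h1, h2⟩ := (hmem x hx u).1 hu
      have hx' : x i = k₀ ∧ G.config n i x = y := by simpa [T] using hx
      have hy : G.config n i (M.solve u) = y := by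
        rw [← M.config_solveDo i k₀ u, h1, hx'.2]
      refine ⟨hy, ?_⟩
      change M.solve u i = k
      rw [solve_apply, hy, h2]
  have hdisj : (T : Set (∀ j, Fin (n j))).PairwiseDisjoint fun x => Set.univ.pi (B x) := by
    intro x hx x' hx' hne
    refine Set.disjoint_left.2 fun u hu hu' => hne ?_
    rw [← ((hmem x hx u).1 hu).1, ((hmem x' hx' u).1 hu').1]
  have hbox : ∀ x, (Measure.pi M.noiseLaw).real (Set.univ.pi (B x)) =
      (∏ j : (Finset.univ.erase i : Finset (Fin d)), M.cpt j (G.config n j x) (x j)) *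
        M.cpt i y k := by
    intro x
    rw [measureReal_def, Measure.pi_pi, ENNReal.toReal_prod,
      ← Finset.prod_erase_mul _ _ (Finset.mem_univ i), hBi]
    congr 1
    rw [← Finset.prod_coe_sort]
    refine Finset.prod_congr rfl fun j _ => ?_
    rw [hBj x j (Finset.ne_of_mem_erase j.2)]
    rfl
  have hm : MeasurableSet (G.config n i ⁻¹' {y} ∩ (fun x : ∀ j, Fin (n j) => x i) ⁻¹' {k}) :=
    Set.Finite.measurableSet (Set.toFinite _)
  rw [law, map_measureReal_apply M.measurable_solve hm, hset,
    measureReal_biUnion_finset hdisj fun x _ => MeasurableSet.univ_pi (hBm x)]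
  simp only [hbox]
  rw [← Finset.sum_mul]
  rfl

theorem sum_cpt (M : DiscreteSCM.{v} G n) (i : Fin d) (y : G.Config n i) :
    ∑ k, M.cpt i y k = 1 := by
  have h := measureReal_biUnion_finset (μ := M.noiseLaw i) (s := Finset.univ)
    (f := fun k => M.mech i y ⁻¹' {k})
    (fun k _ k' _ hkk => Set.disjoint_left.2 fun u hu hu' => hkk (hu.symm.trans hu'))
    fun k _ => M.measurableSet_mech_preimage i y k
  have hU : ⋃ k ∈ Finset.univ, M.mech i y ⁻¹' {k} = Set.univ := by
    ext u
    simp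
  rw [hU, probReal_univ] at h
  exact h.symm

theorem cpt_nonneg (M : DiscreteSCM.{v} G n) (i : Fin d) (y : G.Config n i) (k : Fin (n i)) :
    0 ≤ M.cpt i y k := measureReal_nonneg

theorem cpt_le_one (M : DiscreteSCM.{v} G n) (i : Fin d) (y : G.Config n i) (k : Fin (n i)) :
    M.cpt i y k ≤ 1 := measureReal_le_one

theorem law_real_config (M : DiscreteSCM.{v} G n) (i : Fin d) (k₀ : Fin (n i))
    (y : G.Config n i) :
    M.law.real (G.config n i ⁻¹' {y}) = parentWeight G n i k₀ y (fun j => M.cpt j) := by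
  have h := measureReal_biUnion_finset (μ := M.law) (s := Finset.univ)
    (f := fun k => G.config n i ⁻¹' {y} ∩ (fun x => x i) ⁻¹' {k})
    (fun k _ k' _ hkk => Set.disjoint_left.2 fun u hu hu' => hkk (hu.2.symm.trans hu'.2))
    fun k _ => Set.Finite.measurableSet (Set.toFinite _)
  have hU : ⋃ k ∈ Finset.univ,
      (G.config n i ⁻¹' {y} ∩ (fun x : ∀ j, Fin (n j) => x i) ⁻¹' {k}) =
      G.config n i ⁻¹' {y} := by
    ext u
    simp
  rw [hU] at h
  rw [h]
  simp only [M.law_real_config_inter i k₀]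
  rw [← Finset.mul_sum, sum_cpt, mul_one]

theorem sum_law_real_config (M : DiscreteSCM.{v} G n) (i : Fin d) :
    ∑ y, M.law.real (G.config n i ⁻¹' {y}) = 1 := by
  have h := measureReal_biUnion_finset (μ := M.law) (s := Finset.univ)
    (f := fun y => G.config n i ⁻¹' {y})
    (fun k _ k' _ hkk => Set.disjoint_left.2 fun u hu hu' => hkk (hu.symm.trans hu'))
    fun k _ => Set.Finite.measurableSet (Set.toFinite _)
  have hU : ⋃ y ∈ Finset.univ, G.config n i ⁻¹' {y} = Set.univ := by
    ext u
    simp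
  rw [hU, probReal_univ] at h
  exact h.symm

/-- The conditional law of a node given the configuration `y` of its parents is the row of its table
at `y`. If `y` has probability zero then the conditional law is the zero measure, and the weight
removes the term. -/
theorem condEntropy_eq (M : DiscreteSCM.{v} G n) (i : Fin d) (k₀ : Fin (n i)) :
    M.condEntropy i =
      ∑ y, parentWeight G n i k₀ y (fun j => M.cpt j) * shannonEntropy (M.cpt i y) := by
  rw [condEntropy, condInfo]
  refine Finset.sum_congr rfl fun y _ => ?_
  rw [law_real_config M i k₀]
  rcases eq_or_ne (parentWeight G n i k₀ y fun j => M.cpt j) 0 with h0 | h0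
  · rw [h0, zero_mul, zero_mul]
  · congr 2
    funext k
    rw [measureReal_def, cond_apply (Set.Finite.measurableSet (Set.toFinite _)), ENNReal.toReal_mul,
      ENNReal.toReal_inv, ← measureReal_def, ← measureReal_def, law_real_config_inter M i k₀,
      law_real_config M i k₀, inv_mul_cancel_left₀ h0]

end DiscreteSCM

/-! ### Averaging over the random model -/

namespace IsSymmetricDirichletSCM

variable {d : ℕ} {G : DAG d} {n : Fin d → ℕ} {Ω : Type u} [MeasurableSpace Ω] {P : Measure Ω}
  {M : Ω → DiscreteSCM.{v} G n} {α₀ : ℝ}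

theorem aemeasurable_cpt (h : IsSymmetricDirichletSCM P M α₀) (i : Fin d) :
    AEMeasurable (fun ω => (M ω).cpt i) P :=
  aemeasurable_pi_iff.2 fun y => (h.hasLaw_row i y).aemeasurable

theorem aemeasurable_parentWeight (h : IsSymmetricDirichletSCM P M α₀) (i : Fin d)
    (k₀ : Fin (n i)) (y : G.Config n i) :
    AEMeasurable (fun ω => DiscreteSCM.parentWeight G n i k₀ y fun j => (M ω).cpt j) P :=
  (DiscreteSCM.measurable_parentWeight G n i k₀ y).comp_aemeasurable
    (aemeasurable_pi_iff.2 fun j => h.aemeasurable_cpt j)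

theorem aemeasurable_shannonEntropy_cpt (h : IsSymmetricDirichletSCM P M α₀) (i : Fin d)
    (y : G.Config n i) : AEMeasurable (fun ω => shannonEntropy ((M ω).cpt i y)) P :=
  measurable_shannonEntropy.comp_aemeasurable (h.hasLaw_row i y).aemeasurable

/-- The law of the parents of `i` depends on the tables of the other nodes only. -/
theorem indepFun_parentWeight_shannonEntropy (h : IsSymmetricDirichletSCM P M α₀) (i : Fin d)
    (k₀ : Fin (n i)) (y : G.Config n i) :
    IndepFun (fun ω => DiscreteSCM.parentWeight G n i k₀ y fun j => (M ω).cpt j)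
      (fun ω => shannonEntropy ((M ω).cpt i y)) P := by
  have hi := h.indep.indepFun_finset₀ (Finset.univ.erase i) {i} (by simp) h.aemeasurable_cpt
  have he : Measurable fun θ : ∀ j : ({i} : Finset (Fin d)), G.Config n j → Fin (n j) → ℝ =>
      θ ⟨i, Finset.mem_singleton_self i⟩ y := by fun_prop
  exact hi.comp (DiscreteSCM.measurable_parentWeight G n i k₀ y)
    (measurable_shannonEntropy.comp he)

variable [IsProbabilityMeasure P]

theorem integrable_parentWeight (h : IsSymmetricDirichletSCM P M α₀) (i : Fin d)
    (k₀ : Fin (n i)) (y : G.Config n i) :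
    Integrable (fun ω => DiscreteSCM.parentWeight G n i k₀ y fun j => (M ω).cpt j) P := by
  refine Integrable.of_bound (h.aemeasurable_parentWeight i k₀ y).aestronglyMeasurable 1
    (ae_of_all _ fun ω => ?_)
  rw [← (M ω).law_real_config i k₀ y, Real.norm_of_nonneg measureReal_nonneg]
  exact measureReal_le_one

theorem integrable_shannonEntropy_cpt (h : IsSymmetricDirichletSCM P M α₀) (i : Fin d)
    (y : G.Config n i) : Integrable (fun ω => shannonEntropy ((M ω).cpt i y)) P := by
  refine Integrable.of_bound (h.aemeasurable_shannonEntropy_cpt i y).aestronglyMeasurable (n i)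
    (ae_of_all _ fun ω => ?_)
  rw [Real.norm_of_nonneg (shannonEntropy_nonneg ((M ω).cpt_nonneg i y) ((M ω).cpt_le_one i y))]
  exact shannonEntropy_le ((M ω).cpt_nonneg i y)

theorem integrable_parentWeight_mul (h : IsSymmetricDirichletSCM P M α₀) (i : Fin d)
    (k₀ : Fin (n i)) (y : G.Config n i) :
    Integrable (fun ω => (DiscreteSCM.parentWeight G n i k₀ y fun j => (M ω).cpt j) *
      shannonEntropy ((M ω).cpt i y)) P :=
  (h.indepFun_parentWeight_shannonEntropy i k₀ y).integrable_mul
    (h.integrable_parentWeight i k₀ y) (h.integrable_shannonEntropy_cpt i y)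

theorem integrable_condEntropy (h : IsSymmetricDirichletSCM P M α₀) (i : Fin d)
    (k₀ : Fin (n i)) : Integrable (fun ω => (M ω).condEntropy i) P := by
  simp only [fun ω => (M ω).condEntropy_eq i k₀]
  exact integrable_finsetSum _ fun y _ => h.integrable_parentWeight_mul i k₀ y

theorem expectedCondEntropy_eq (h : IsSymmetricDirichletSCM P M α₀) (hα : 0 < α₀)
    (hn : ∀ i, 0 < n i) (i : Fin d) :
    expectedCondEntropy P M i = dirichletMeanEntropy (n i) (G.numConfigs n i) α₀ := by
  let k₀ : Fin (n i) := ⟨0, hn i⟩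
  have hK : (0 : ℝ) < G.numConfigs n i := by
    have : Nonempty (G.Config n i) := ⟨fun k => ⟨0, hn k⟩⟩
    exact_mod_cast Fintype.card_pos (α := G.Config n i)
  have hrow : ∀ y, ∫ ω, shannonEntropy ((M ω).cpt i y) ∂P =
      dirichletMeanEntropy (n i) (G.numConfigs n i) α₀ := fun y =>
    ((h.hasLaw_row i y).integral_comp measurable_shannonEntropy.aestronglyMeasurable).trans
      (integral_shannonEntropy_symmetric_dirichletMeasure (hn i) hK hα)
  have hsum : ∑ y, ∫ ω, (DiscreteSCM.parentWeight G n i k₀ y fun j => (M ω).cpt j) ∂P = 1 := by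
    rw [← integral_finsetSum _ fun y _ => h.integrable_parentWeight i k₀ y]
    simp only [← fun ω => (M ω).law_real_config i k₀, DiscreteSCM.sum_law_real_config]
    simp
  simp only [expectedCondEntropy, fun ω => (M ω).condEntropy_eq i k₀]
  rw [integral_finsetSum _ fun y _ => h.integrable_parentWeight_mul i k₀ y]
  have hy : ∀ y, ∫ ω, (DiscreteSCM.parentWeight G n i k₀ y fun j => (M ω).cpt j) *
      shannonEntropy ((M ω).cpt i y) ∂P =
      (∫ ω, (DiscreteSCM.parentWeight G n i k₀ y fun j => (M ω).cpt j) ∂P) *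
        dirichletMeanEntropy (n i) (G.numConfigs n i) α₀ := fun y => by
    rw [(h.indepFun_parentWeight_shannonEntropy i k₀ y).integral_fun_mul_eq_mul_integral
      (h.aemeasurable_parentWeight i k₀ y).aestronglyMeasurable
      (h.aemeasurable_shannonEntropy_cpt i y).aestronglyMeasurable, hrow]
  rw [Finset.sum_congr rfl fun y _ => hy y, ← Finset.sum_mul, hsum, one_mul]

end IsSymmetricDirichletSCM

theorem proposition1 {d : ℕ} (G : DAG d) (n : Fin d → ℕ) (hn : ∀ i, 2 ≤ n i) :
    ∃ A : ℝ, 0 < A ∧ ∀ α₀ : ℝ, A ≤ α₀ →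
      ∀ (Ω : Type u) [MeasurableSpace Ω] (P : Measure Ω) [IsProbabilityMeasure P]
        (M : Ω → DiscreteSCM.{v} G n), IsSymmetricDirichletSCM P M α₀ →
      (∀ i, ∀ j ∈ G.children i,
        0 ≤ Real.log ((n j : ℝ) / (n i : ℝ)) +
          α₀⁻¹ * ((G.numConfigs n i : ℝ) * cCoeff (n i) -
            (G.numConfigs n j : ℝ) * cCoeff (n j))) →
      (∀ i, Integrable (fun ω => (M ω).condEntropy i) P) ∧
        NonDecreasingRandomness G (expectedCondEntropy P M) := by
  have hn0 : ∀ i, 0 < n i := fun i => zero_lt_two.trans_le (hn i)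
  have hK : ∀ i, 0 < G.numConfigs n i := fun i =>
    have : Nonempty (G.Config n i) := ⟨fun k => ⟨0, hn0 k⟩⟩
    Fintype.card_pos
  have hev := Filter.eventually_all.2 fun i => Filter.eventually_all.2 fun j =>
    eventually_dirichletMeanEntropy_le_of_cCoeff (hn i) (hn j) (hK i) (hK j)
  obtain ⟨A, hA⟩ := Filter.eventually_atTop.1 hev
  refine ⟨max A 1, lt_max_of_lt_right one_pos, fun α₀ hα Ω _ P _ M hM hc => ⟨fun i =>
    hM.integrable_condEntropy i ⟨0, hn0 i⟩, fun i hi => Finset.le_inf' hi _ fun j hj => ?_⟩⟩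
  have hα0 : 0 < α₀ := one_pos.trans_le ((le_max_right _ _).trans hα)
  rw [hM.expectedCondEntropy_eq hα0 hn0, hM.expectedCondEntropy_eq hα0 hn0]
  exact hA α₀ ((le_max_left _ _).trans hα) i j (hc i j hj)
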